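/- Work with oriented Legendrian links in $\mathbb R^3$ with the contact structure $\ker(dz-y\,dx)$, up to Legendrian isotopy. They are described by their front ($xz$-) projections, which have cusps and no vertical tangents and in which the strand of lesser slope is on top at each crossing; two fronts describe equivalent Legendrian links iff they are related by planar isotopies that introduce no vertical tangents and Legendrian Reidemeister moves. An *oriented Legendrian surgery* replaces, in some front, two vertically adjacent, oppositely oriented strands without cusps or crossings (a $0$-tangle) by two arcs with one cusp each (an $\infty$-tangle): a right cusp joining the two left ends and a left cusp joining the two right ends, with the induced orientation. An *unknotting surgery string of length $n$* for $\Lambda$ is a vector $(\Lambda_n,\dots,\Lambda_0)$ of oriented Legendrian links with $\Lambda_n=\Lambda$, with each $\Lambda_j$ ($j<n$) obtained from $\Lambda_{j+1}$ by an oriented Legendrian surgery, and with $\Lambda_0$ topologically an unknot. The *Legendrian surgery unknotting number* $\sigma_0(\Lambda)$ is the minimal length of such a string. A crossing of a front is *positive* if both strands point to the same side of the vertical line through it. A positive crossing is of * *S form* if the strand of negative slope is the middle part of an S: its upper left end runs directly into a left cusp, whose other branch passes back to the right above the crossing, and its lower right end runs directly into a right cusp, whose other branch passes back to the left below the crossing.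 The rest of the front lies outside this picture: a disc that the front meets in just this arc and the other strand through the crossing, which enters on the left between the middle part and the lower branch and leaves on the right between the upper branch and the middle part; * *Z form* if it is the mirror image of an S form in a horizontal line; * *hooked-X form* if its two upper ends are hooked (the upper left end runs directly into a left cusp, whose other branch leaves to the right above the crossing, and the upper right end runs directly into a right cusp, whose other branch leaves to the left above the crossing, and the picture contains nothing else of the front; the two branches may continue in any way outside it, and in particular may cross each other), or if it is the mirror image of this in a horizontal line. **Lemma.** Let $\Lambda$ be an oriented Legendrian knot that is topologically non-trivial. If $\Lambda$ has a front projection with a positive crossing in S, Z or hooked-X form such that topologically changing this one crossing gives a diagram of the unknot, then $$\sigma_0(\Lambda)\le 2 .$$ -/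

import Mathlib

namespace Legendrian

/-! ### Oriented diagrams in the `xz`-plane, read from left to right

A link diagram in general position meets every vertical line in finitely many points, and its
special points have different `x`-coordinates. Reading it from left to right, it is the list of its
special points: left and right turning points, which are the cusps of a front and the vertical
tangencies of a smooth diagram, and crossings. Each comes with its height, the number of strands
below it. Between two special points the strands are numbered `0, 1, 2, …` from bottom to top. -/

/-- The kinds of special points. A left turning point creates two strands that are oppositely
oriented; `left up` records whether the upper one of them points to the right (`up = true`) or to
the left (`up = false`). The label of a crossing carries crossing information; `Unit` is used for
fronts, which need none, and `Bool` for smooth diagrams. -/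
inductive Kind (C : Type) where
  | left (up : Bool)
  | right
  | cross (c : C)

/-- The number of strands that end at a special point when read from the left. -/
def Kind.ins {C : Type} : Kind C → ℕ
  | .left _ => 0
  | .right => 2
  | .cross _ => 2

/-- The number of strands that start at a special point when read from the left. -/
def Kind.outs {C : Type} : Kind C → ℕ
  | .left _ => 2
  | .right => 0
  | .cross _ => 2

/-- A special point: its kind and the number of strands below it. -/
structure Event (C : Type) where
  kind : Kind C
  pos : ℕ

/-- The effect of a special point on the list of directions of the strands, from bottom to top
(`true` is a strand that points to the right). It is `none` when the special point does not fit: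
strands are missing, or the strands that meet at a right turning point are not oriented
coherently. -/
def Event.act {C : Type} (e : Event C) (s : List Bool) : Option (List Bool) :=
  match e.kind with
  | .left up => if e.pos ≤ s.length then some (s.take e.pos ++ (!up) :: up :: s.drop e.pos) else none
  | .right =>
    match s.drop e.pos with
    | a :: b :: t => if a = b then none else some (s.take e.pos ++ t)
    | _ => none
  | .cross _ =>
    match s.drop e.pos with
    | a :: b :: t => some (s.take e.pos ++ b :: a :: t)
    | _ => none

/-- The directions of the strands to the right of a list of special points, given those to the
left of it. -/
def run {C : Type} : List (Event C) → List Bool → Option (List Bool)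
  | [], s => some s
  | e :: w, s => (e.act s).bind (run w)

/-- An oriented link diagram: special points that start and end with no strands. -/
structure Diagram (C : Type) where
  word : List (Event C)
  closed : run word [] = some []

/-- `D` and `E` differ by replacing a part `a` of the diagram by `b`, where `R a b`. -/
def Diagram.Step {C : Type} (R : List (Event C) → List (Event C) → Prop) (D E : Diagram C) : Prop :=
  ∃ pre a b post, R a b ∧ D.word = pre ++ a ++ post ∧ E.word = pre ++ b ++ post

/-- `(i, j)` is a point of the diagram: there is a strand number `j` right after the first `i`
special points. -/
def Diagram.IsPoint {C : Type} (D : Diagram C) (x : ℕ × ℕ) : Prop :=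
  ∃ s, run (D.word.take x.1) [] = some s ∧ x.2 < s.length

/-- Two points of the diagram lie on the link next to each other: they are joined across one
special point, straight through it in the case of a crossing. -/
inductive Diagram.Joined {C : Type} (D : Diagram C) : ℕ × ℕ → ℕ × ℕ → Prop
  | below {i j p : ℕ} {k : Kind C} (h : D.word[i]? = some ⟨k, p⟩) (hj : j < p) :
      Diagram.Joined D (i, j) (i + 1, j)
  | above {i j p : ℕ} {k : Kind C} (h : D.word[i]? = some ⟨k, p⟩) (hj : p ≤ j) :
      Diagram.Joined D (i, j + k.ins) (i + 1, j + k.outs)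
  | rise {i p : ℕ} {c : C} (h : D.word[i]? = some ⟨.cross c, p⟩) :
      Diagram.Joined D (i, p) (i + 1, p + 1)
  | fall {i p : ℕ} {c : C} (h : D.word[i]? = some ⟨.cross c, p⟩) :
      Diagram.Joined D (i, p + 1) (i + 1, p)
  | left {i p : ℕ} {up : Bool} (h : D.word[i]? = some ⟨.left up, p⟩) :
      Diagram.Joined D (i + 1, p) (i + 1, p + 1)
  | right {i p : ℕ} (h : D.word[i]? = some ⟨.right, p⟩) :
      Diagram.Joined D (i, p) (i, p + 1)

/-- The diagram has exactly one component. -/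
def Diagram.IsKnot {C : Type} (D : Diagram C) : Prop :=
  (∃ x, D.IsPoint x) ∧ ∀ x y, D.IsPoint x → D.IsPoint y → Relation.EqvGen D.Joined x y

/-! ### Smooth links -/

/-- The local moves on smooth link diagrams. The label of a crossing is `true` when the strand of
lesser slope, which comes from above on the left, is the overstrand, and `false` when it is the
understrand. -/
inductive SmoothMove : List (Event Bool) → List (Event Bool) → Prop
  /-- Planar isotopy: two special points, the second one above the first one, trade their
  `x`-coordinates. -/
  | far (a b : Kind Bool) (p q : ℕ) (h : p ≤ q) :
      SmoothMove [⟨a, p⟩, ⟨b, q + a.outs⟩] [⟨b, q + a.ins⟩, ⟨a, p⟩]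
  /-- Planar isotopy: an S-shaped or a Z-shaped arc is straightened. -/
  | zigzag (k : ℕ) (d : Bool) : SmoothMove [⟨.left d, k + 1⟩, ⟨.right, k⟩] []
  | zigzag' (k : ℕ) (d : Bool) : SmoothMove [⟨.left d, k⟩, ⟨.right, k + 1⟩] []
  /-- Planar isotopy: a crossing is turned past a turning point. -/
  | turnLeft (k : ℕ) (d c : Bool) :
      SmoothMove [⟨.left d, k⟩, ⟨.cross c, k + 1⟩] [⟨.left d, k + 1⟩, ⟨.cross !c, k⟩]
  | turnRight (k : ℕ) (c : Bool) :
      SmoothMove [⟨.cross c, k + 1⟩, ⟨.right, k⟩] [⟨.cross !c, k⟩, ⟨.right, k + 1⟩]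
  /-- Reidemeister move I. -/
  | r1Left (k : ℕ) (d c : Bool) : SmoothMove [⟨.left d, k⟩, ⟨.cross c, k⟩] [⟨.left !d, k⟩]
  | r1Right (k : ℕ) (c : Bool) : SmoothMove [⟨.cross c, k⟩, ⟨.right, k⟩] [⟨.right, k⟩]
  /-- Reidemeister move II. -/
  | r2 (k : ℕ) (c : Bool) : SmoothMove [⟨.cross c, k⟩, ⟨.cross !c, k⟩] []
  /-- Reidemeister move III; `h` says that one of the three strands is on top and another one at
  the bottom. -/
  | r3 (k : ℕ) (a b c : Bool) (h : a = b ∨ b = c) :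
      SmoothMove [⟨.cross a, k⟩, ⟨.cross b, k + 1⟩, ⟨.cross c, k⟩]
        [⟨.cross c, k + 1⟩, ⟨.cross b, k⟩, ⟨.cross a, k + 1⟩]

/-- Oriented smooth link types: diagrams up to planar isotopy and Reidemeister moves. -/
def LinkType : Type := Quot (Diagram.Step SmoothMove)

/-- The smooth unknot. -/
def unknot : LinkType := Quot.mk _ ⟨[⟨.left true, 0⟩, ⟨.right, 0⟩], rfl⟩

/-! ### Legendrian links -/

/-- An oriented front diagram, the `xz`-projection of an oriented Legendrian link in `ℝ³` with the
contact structure `ker (dz - y dx)`: the turning points are cusps, there are no vertical tangents,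
and at a crossing the strand of lesser slope is on top. -/
abbrev Front : Type := Diagram Unit

/-- The local moves on fronts: planar isotopy that does not introduce vertical tangents, and the
Legendrian Reidemeister moves. -/
inductive FrontMove : List (Event Unit) → List (Event Unit) → Prop
  | far (a b : Kind Unit) (p q : ℕ) (h : p ≤ q) :
      FrontMove [⟨a, p⟩, ⟨b, q + a.outs⟩] [⟨b, q + a.ins⟩, ⟨a, p⟩]
  /-- Move I and its reflection in a horizontal line. -/
  | r1 (k : ℕ) (d : Bool) :
      FrontMove [⟨.left d, k + 1⟩, ⟨.cross (), k⟩, ⟨.right, k + 1⟩] []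
  | r1' (k : ℕ) (d : Bool) :
      FrontMove [⟨.left d, k⟩, ⟨.cross (), k + 1⟩, ⟨.right, k⟩] []
  /-- Move II, a cusp passes a strand, and its three reflections. -/
  | r2Left (k : ℕ) (d : Bool) :
      FrontMove [⟨.left d, k + 1⟩, ⟨.cross (), k⟩, ⟨.cross (), k + 1⟩] [⟨.left d, k⟩]
  | r2Left' (k : ℕ) (d : Bool) :
      FrontMove [⟨.left d, k⟩, ⟨.cross (), k + 1⟩, ⟨.cross (), k⟩] [⟨.left d, k + 1⟩]
  | r2Right (k : ℕ) :
      FrontMove [⟨.cross (), k + 1⟩, ⟨.cross (), k⟩, ⟨.right, k + 1⟩] [⟨.right, k⟩]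
  | r2Right' (k : ℕ) :
      FrontMove [⟨.cross (), k⟩, ⟨.cross (), k + 1⟩, ⟨.right, k⟩] [⟨.right, k + 1⟩]
  /-- Move III. -/
  | r3 (k : ℕ) :
      FrontMove [⟨.cross (), k⟩, ⟨.cross (), k + 1⟩, ⟨.cross (), k⟩]
        [⟨.cross (), k + 1⟩, ⟨.cross (), k⟩, ⟨.cross (), k + 1⟩]

/-- Oriented Legendrian links up to equivalence (Legendrian isotopy): fronts up to planar isotopy
without vertical tangents and Legendrian Reidemeister moves. -/
def LegendrianLink : Type := Quot (Diagram.Step FrontMove)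

/-- The Legendrian link with a given front. -/
def Front.link (F : Front) : LegendrianLink := Quot.mk _ F

/-- A special point of a front as a special point of a smooth diagram, in which a crossing gets the
label `c`. -/
def Event.smooth (c : Bool) (e : Event Unit) : Event Bool :=
  match e.kind with
  | .left up => ⟨.left up, e.pos⟩
  | .right => ⟨.right, e.pos⟩
  | .cross _ => ⟨.cross c, e.pos⟩

theorem Event.act_smooth (c : Bool) (e : Event Unit) (s : List Bool) :
    (e.smooth c).act s = e.act s := by
  rcases e with ⟨_ | _ | _, p⟩ <;> rfl

theorem run_mapIdx_smooth (f : ℕ → Bool) (w : List (Event Unit)) (s : List Bool) :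
    run (w.mapIdx fun j e => e.smooth (f j)) s = run w s := by
  induction w generalizing f s with
  | nil => rfl
  | cons e w ih =>
    rw [List.mapIdx_cons]
    simp only [run, Event.act_smooth]
    congr 1
    funext t
    exact ih (fun j => f (j + 1)) t

/-- The underlying smooth link diagram of a front: the strand of lesser slope is on top. -/
def Front.diagram (F : Front) : Diagram Bool where
  word := F.word.mapIdx fun _ e => e.smooth true
  closed := (run_mapIdx_smooth (fun _ => true) F.word []).trans F.closed

/-- The smooth diagram obtained from a front by topologically changing the crossing with
number `i` in the list of special points: there, the strand of greater slope is on top. -/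
def Front.changeCrossing (F : Front) (i : ℕ) : Diagram Bool where
  word := F.word.mapIdx fun j e => e.smooth (j ≠ i)
  closed := (run_mapIdx_smooth (fun j => j ≠ i) F.word []).trans F.closed

/-- The Legendrian link is a knot: it has one component. -/
def LegendrianLink.IsKnot (L : LegendrianLink) : Prop :=
  ∃ F : Front, F.link = L ∧ Diagram.IsKnot F

/-- The Legendrian link is topologically an unknot. -/
def LegendrianLink.IsUnknot (L : LegendrianLink) : Prop :=
  ∃ F : Front, F.link = L ∧ (Quot.mk _ F.diagram : LinkType) = unknot

/-! ### The surgery unknotting number -/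

/-- `L'` is obtained from `L` by an oriented Legendrian surgery: in a front of `L`, two neighbouring
strands that are oppositely oriented and have no crossings or cusps (numbers `p` and `p + 1` to the
right of `pre`) are replaced by a right cusp on the left and a left cusp on the right, with
the orientation at the four ends unchanged. -/
def Surgery (L L' : LegendrianLink) : Prop :=
  ∃ (F F' : Front) (pre post : List (Event Unit)) (s : List Bool) (p : ℕ) (d : Bool),
    F.link = L ∧ F'.link = L' ∧
    F.word = pre ++ post ∧
    F'.word = pre ++ [⟨.right, p⟩, ⟨.left d, p⟩] ++ post ∧
    run pre [] = some s ∧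
    run ([⟨.right, p⟩, ⟨.left d, p⟩] : List (Event Unit)) s = some s

/-- There is an oriented, unknotting surgery string `(L n, …, L 1, L 0)` of length `n` for `L`. -/
def HasUnknottingString (L : LegendrianLink) (n : ℕ) : Prop :=
  ∃ S : Fin (n + 1) → LegendrianLink,
    S (Fin.last n) = L ∧ (∀ j : Fin n, Surgery (S j.succ) (S j.castSucc)) ∧ (S 0).IsUnknot

/-- The Legendrian surgery unknotting number `σ₀`: the minimal length of an oriented, unknotting
surgery string (`⊤` if there were none). -/
noncomputable def surgeryUnknottingNumber (L : LegendrianLink) : ℕ∞ :=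
  ⨅ (n : ℕ) (_ : HasUnknottingString L n), (n : ℕ∞)

/-! ### Positive crossings in S, Z and hooked-X form

Each form is a picture in a disc. A front that contains it can be moved by a planar isotopy without
vertical tangents so that no other special points come between those of the picture, except, for
the hooked-X form, those of the part of the front that lies between the two hooks. -/

/-- The special point number `i` of the front is a positive crossing: both strands point to the
same side. -/
def Front.IsPositiveCrossing (F : Front) (i : ℕ) : Prop :=
  ∃ (k : ℕ) (s : List Bool) (a : Bool), F.word[i]? = some ⟨.cross (), k⟩ ∧
    run (F.word.take i) [] = some s ∧ s[k]? = some a ∧ s[k + 1]? = some a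

/-- The crossing number `i` is of S form: the strand of negative slope is the middle part of an S.
Its upper left end runs into a left cusp, whose other branch passes to the right above the crossing;
its lower right end runs into a right cusp, whose other branch passes to the left below the
crossing. -/
def Front.IsSForm (F : Front) (i : ℕ) : Prop :=
  ∃ (pre post : List (Event Unit)) (k : ℕ) (d : Bool), i = pre.length + 1 ∧
    F.word = pre ++ [⟨.left d, k + 2⟩, ⟨.cross (), k + 1⟩, ⟨.right, k⟩] ++ post

/-- The crossing number `i` is of Z form: the strand of positive slope is the middle part of a Z.
Its lower left end runs into a left cusp, whose other branch passes to the right below the crossing;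
its upper right end runs into a right cusp, whose other branch passes to the left above the
crossing. -/
def Front.IsZForm (F : Front) (i : ℕ) : Prop :=
  ∃ (pre post : List (Event Unit)) (k : ℕ) (d : Bool), i = pre.length + 1 ∧
    F.word = pre ++ [⟨.left d, k⟩, ⟨.cross (), k + 1⟩, ⟨.right, k + 2⟩] ++ post

/-- The crossing number `i` is of hooked-X form, with its two upper ends hooked: the upper left end
runs into a left cusp, whose other branch leaves to the right above the crossing, and the upper
right end runs into a right cusp, whose other branch leaves to the left above the crossing. Nothing
is assumed about the part `Q` of the front above the crossing in which these two branches
continue (they may cross each other there). -/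
def Front.IsUpperHookedX (F : Front) (i : ℕ) : Prop :=
  ∃ (pre Q post : List (Event Unit)) (k : ℕ) (d : Bool), i = pre.length + 1 ∧
    F.word = pre ++ [⟨.left d, k + 1⟩, ⟨.cross (), k⟩] ++ Q ++ [⟨.right, k + 1⟩] ++ post ∧
    ∀ e ∈ Q, k + 2 ≤ e.pos

/-- The crossing number `i` is of hooked-X form, with its two lower ends hooked: the reflection of
the previous form in a horizontal line. The part `Q` of the front involves only the strands below
the two that come out of the crossing: it turns the `k + 1` strands there into `l + 1` strands. -/
def Front.IsLowerHookedX (F : Front) (i : ℕ) : Prop :=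
  ∃ (pre Q post : List (Event Unit)) (k l : ℕ) (d : Bool) (s t : List Bool), i = pre.length + 1 ∧
    F.word = pre ++ [⟨.left d, k⟩, ⟨.cross (), k + 1⟩] ++ Q ++ [⟨.right, l⟩] ++ post ∧
    run (pre ++ [⟨.left d, k⟩, ⟨.cross (), k + 1⟩]) [] = some s ∧
    run Q (s.take (k + 1)) = some t ∧ t.length = l + 1

/-- The crossing number `i` is of hooked-X form. -/
def Front.IsHookedXForm (F : Front) (i : ℕ) : Prop :=
  F.IsUpperHookedX i ∨ F.IsLowerHookedX i

end Legendrian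

/-! Two surgeries, both supported near the given crossing, turn the front into one whose smooth
diagram is, up to isotopy, the old diagram with that crossing changed; by hypothesis this is the
unknot. Each surgery is placed so that one of its new cusps closes up a loop with an existing
crossing and cusp, and Legendrian move I removes the loop together with the crossing.

In S and Z form the first surgery, just left of the picture, kills the crossing and leaves a right
cusp facing a left cusp (two parallel strands cut). Pulling these cusps past each other by move II
makes two crossings, and the second surgery removes one of them. What remains is a single crossing
of the oppositely oriented strands, with a zigzag that is invisible smoothly
(`exists_surgery_cusps`).

In hooked-X form the first surgery, just right of the crossing, removes it. Move II then pushes the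
left cusp through the neighbouring strand. One of the two new crossings slides past the rest `Q` of
the picture (`conv_cross_below`, `conv_cross_above`) and is removed by the second surgery.

In each case the surviving crossing is the old one turned past a cusp. Turning exchanges lesser and
greater slope, so the front convention at the new crossing is the changed crossing at the old one.

`Conv` records that two words act alike on the strands and are interchangeable in every diagram;
`exists_surgery` and `isUnknot_of_changeCrossing` reduce each form to a few such local exchanges. -/

namespace Legendrian

/-! ### How words act on strands -/

theorem run_append {C : Type} (v w : List (Event C)) (s : List Bool) :
    run (v ++ w) s = (run v s).bind (run w) := by
  induction v generalizing s with
  | nil => rfl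
  | cons e v ih =>
    simp only [List.cons_append, run]
    cases e.act s <;> simp [ih]

theorem run_append_of_eq {C : Type} {v w : List (Event C)} {s t u : List Bool}
    (hv : run v s = some t) (hw : run w t = some u) : run (v ++ w) s = some u := by
  rw [run_append, hv]; exact hw

theorem exists_run_of_append {C : Type} {v w : List (Event C)} {s u : List Bool}
    (h : run (v ++ w) s = some u) : ∃ t, run v s = some t ∧ run w t = some u := by
  rw [run_append] at h
  exact Option.bind_eq_some_iff.1 h

/-- A special point moved up by `n` strands. -/
def Event.shift {C : Type} (n : ℕ) (e : Event C) : Event C := ⟨e.kind, n + e.pos⟩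

theorem Event.act_shift {C : Type} (e : Event C) (x s : List Bool) :
    (e.shift x.length).act (x ++ s) = (e.act s).map (x ++ ·) := by
  have ht : ∀ p, (x ++ s).take (x.length + p) = x ++ s.take p := fun p => by
    rw [List.take_append, List.take_of_length_le (by omega), Nat.add_sub_cancel_left]
  have hd : ∀ p, (x ++ s).drop (x.length + p) = s.drop p := fun p => by
    rw [List.drop_append, List.drop_eq_nil_of_le (by omega), Nat.add_sub_cancel_left,
      List.nil_append]
  rcases e with ⟨_ | _ | _, p⟩
  · simp only [Event.act, Event.shift, ht, hd, List.length_append, Nat.add_le_add_iff_left]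
    split_ifs <;> simp
  all_goals
    simp only [Event.act, Event.shift, ht, hd]
    rcases s.drop p with _ | ⟨a, _ | ⟨b, t⟩⟩ <;> simp
  all_goals split_ifs <;> simp

/-- Strands below all special points do not matter. -/
theorem run_shift {C : Type} (w : List (Event C)) (x s : List Bool) :
    run (w.map (Event.shift x.length)) (x ++ s) = (run w s).map (x ++ ·) := by
  induction w generalizing s with
  | nil => rfl
  | cons e w ih =>
    simp only [List.map_cons, run, Event.act_shift]
    cases e.act s <;> simp [ih]

theorem run_shift_of_eq {C : Type} {w : List (Event C)} {s t : List Bool} (x : List Bool)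
    (h : run w s = some t) : run (w.map (Event.shift x.length)) (x ++ s) = some (x ++ t) := by
  rw [run_shift, h]; rfl

theorem Event.act_append_right {C : Type} {e : Event C} {s t : List Bool} (v : List Bool)
    (h : e.act s = some t) : e.act (s ++ v) = some (t ++ v) := by
  rcases e with ⟨_ | _ | _, p⟩
  · simp only [Event.act] at h ⊢
    split_ifs at h with hp
    rw [if_pos (by simp; omega)]
    simp only [Option.some.injEq] at h
    subst h
    simp [List.take_append_of_le_length hp, List.drop_append_of_le_length hp]
  all_goals
    simp only [Event.act] at h ⊢
    split at h
    next a b r hr =>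
      have hp : p ≤ s.length := by
        by_contra hp
        rw [List.drop_eq_nil_of_le (by omega)] at hr
        simp at hr
      rw [List.drop_append_of_le_length hp, hr, List.take_append_of_le_length hp]
      simp only [List.cons_append]
      first
      | split_ifs at h ⊢ with hab
        simp only [Option.some.injEq] at h
        subst h
        simp
      | simp only [Option.some.injEq] at h
        subst h
        simp
    next => simp at h

/-- Additional strands above all special points do not matter. -/
theorem run_append_right {C : Type} {w : List (Event C)} {s t : List Bool} (v : List Bool)
    (h : run w s = some t) : run w (s ++ v) = some (t ++ v) := by
  induction w generalizing s with
  | nil => simp only [run, Option.some.injEq] at h ⊢; rw [h]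
  | cons e w ih =>
    simp only [run] at h ⊢
    obtain ⟨u, hu, hw⟩ := Option.bind_eq_some_iff.1 h
    rw [Event.act_append_right v hu]
    exact ih hw

/-- The number of strands changes by what a special point consumes and creates. -/
theorem Event.act_length {C : Type} {e : Event C} {s t : List Bool} (h : e.act s = some t) :
    ∃ n, e.pos + n + e.kind.ins = s.length ∧ e.pos + n + e.kind.outs = t.length := by
  rcases e with ⟨_ | _ | _, p⟩
  · simp only [Event.act] at h
    split_ifs at h with hp
    simp only [Option.some.injEq] at h
    subst h
    refine ⟨s.length - p, ?_, ?_⟩ <;> simp [Kind.ins, Kind.outs] <;> omega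
  all_goals
    simp only [Event.act] at h
    split at h
    next a b r hr =>
      have hl : (s.drop p).length = r.length + 2 := by rw [hr]; rfl
      rw [List.length_drop] at hl
      first
      | split_ifs at h with hab
        simp only [Option.some.injEq] at h
        subst h
        refine ⟨r.length, ?_, ?_⟩ <;> simp [Kind.ins, Kind.outs] <;> omega
      | simp only [Option.some.injEq] at h
        subst h
        refine ⟨r.length, ?_, ?_⟩ <;> simp [Kind.ins, Kind.outs] <;> omega
    next => simp at h

theorem run_nil {C : Type} (s : List Bool) : run ([] : List (Event C)) s = some s := rfl

/-- With heights written as `x.length + n`, `simp` can evaluate a concrete word above an unknown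
stack `x` of strands. The two variants with height `x.length` cover `n = 0`, where no sum is
visible. -/
theorem run_cons_add {C : Type} (k : Kind C) (n : ℕ) (w : List (Event C)) (x s : List Bool) :
    run (⟨k, x.length + n⟩ :: w) (x ++ s) =
      (Event.act ⟨k, n⟩ s).bind fun t => run w (x ++ t) := by
  have := Event.act_shift ⟨k, n⟩ x s
  simp only [Event.shift] at this
  rw [run, this, Option.bind_map]
  rfl

theorem act_add {C : Type} (k : Kind C) (n : ℕ) (x s : List Bool) :
    Event.act ⟨k, x.length + n⟩ (x ++ s) = (Event.act ⟨k, n⟩ s).map (x ++ ·) :=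
  Event.act_shift ⟨k, n⟩ x s

theorem act_length {C : Type} (k : Kind C) (x s : List Bool) :
    Event.act ⟨k, x.length⟩ (x ++ s) = (Event.act ⟨k, 0⟩ s).map (x ++ ·) :=
  act_add k 0 x s

theorem run_cons_length {C : Type} (k : Kind C) (w : List (Event C)) (x s : List Bool) :
    run (⟨k, x.length⟩ :: w) (x ++ s) = (Event.act ⟨k, 0⟩ s).bind fun t => run w (x ++ t) :=
  run_cons_add k 0 w x s

/-! ### Interchangeable words -/

theorem closed_replace {C : Type} {pre a b post : List (Event C)} {s t : List Bool}
    (hp : run pre [] = some s) (ha : run a s = some t) (hb : run b s = some t)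
    (h : run (pre ++ a ++ post) [] = some []) : run (pre ++ b ++ post) [] = some [] := by
  rw [run_append, run_append_of_eq hp ha] at h
  exact run_append_of_eq (run_append_of_eq hp hb) h

/-- The words `a` and `b`, which both turn the strands `s` into `t`, can be exchanged for each other
in any diagram without changing its class. -/
def Conv {C : Type} (R : List (Event C) → List (Event C) → Prop) (s t : List Bool)
    (a b : List (Event C)) : Prop :=
  run a s = some t ∧ run b s = some t ∧
    ∀ (pre post : List (Event C)) (D E : Diagram C), run pre [] = some s →
      D.word = pre ++ a ++ post → E.word = pre ++ b ++ post →
      (Quot.mk (Diagram.Step R) D) = Quot.mk (Diagram.Step R) E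

namespace Conv

variable {C : Type} {R : List (Event C) → List (Event C) → Prop} {s t u r : List Bool}
  {a b c : List (Event C)}

theorem of_move (h : R a b) (ha : run a s = some t) (hb : run b s = some t) : Conv R s t a b :=
  ⟨ha, hb, fun pre post _ _ _ hD hE => Quot.sound ⟨pre, a, b, post, h, hD, hE⟩⟩

theorem refl (ha : run a s = some t) : Conv R s t a a :=
  ⟨ha, ha, fun pre post D E _ hD hE => by
    rcases D with ⟨w, hw⟩
    rcases E with ⟨w', hw'⟩
    obtain rfl : w = w' := hD.trans hE.symm
    rfl⟩

theorem symm (h : Conv R s t a b) : Conv R s t b a :=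
  ⟨h.2.1, h.1, fun pre post D E hp hD hE => (h.2.2 pre post E D hp hE hD).symm⟩

/-- The intermediate word has to be a closed diagram itself; this is why `Conv` also records the
effect on strands. -/
theorem trans (h : Conv R s t a b) (h' : Conv R s t b c) : Conv R s t a c :=
  ⟨h.1, h'.2.1, fun pre post D E hp hD hE =>
    (h.2.2 pre post D ⟨pre ++ b ++ post, closed_replace hp h.1 h.2.1 (hD ▸ D.closed)⟩ hp hD
      rfl).trans (h'.2.2 pre post _ E hp rfl hE)⟩

theorem append_left {p : List (Event C)} (hp : run p r = some s) (h : Conv R s t a b) :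
    Conv R r t (p ++ a) (p ++ b) :=
  ⟨run_append_of_eq hp h.1, run_append_of_eq hp h.2.1, fun pre post D E hq hD hE =>
    h.2.2 (pre ++ p) post D E (run_append_of_eq hq hp) (by simpa using hD) (by simpa using hE)⟩

theorem append_right {q : List (Event C)} (h : Conv R s t a b) (hq : run q t = some u) :
    Conv R s u (a ++ q) (b ++ q) :=
  ⟨run_append_of_eq h.1 hq, run_append_of_eq h.2.1 hq, fun pre post D E hp hD hE =>
    h.2.2 pre (q ++ post) D E hp (by simpa using hD) (by simpa using hE)⟩

/-- A local move inside a word. -/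
theorem of_move_within (p : List (Event C)) {a b : List (Event C)} (q : List (Event C))
    (h : R a b) (hw : run (p ++ a ++ q) s = some t) (hw' : run (p ++ b ++ q) s = some t) :
    Conv R s t (p ++ a ++ q) (p ++ b ++ q) :=
  ⟨hw, hw', fun pre post D E _ hD hE =>
    Quot.sound ⟨pre ++ p, a, b, q ++ post, h, by simpa using hD, by simpa using hE⟩⟩

end Conv

/-! ### Sliding a crossing past a part of a front -/

/-- A crossing above a part of a front moves from its left to its right. -/
theorem conv_cross_above {Q : List (Event Unit)} {u t : List Bool} (a b : Bool) (v : List Bool)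
    (h : run Q u = some t) :
    Conv FrontMove (u ++ a :: b :: v) (t ++ b :: a :: v)
      (⟨.cross (), u.length⟩ :: Q) (Q ++ [⟨.cross (), t.length⟩]) := by
  have hcross : ∀ u : List Bool,
      run [(⟨.cross (), u.length⟩ : Event Unit)] (u ++ a :: b :: v) = some (u ++ b :: a :: v) :=
    fun u => by simp [run, Event.act]
  induction Q generalizing u with
  | nil =>
    simp only [run, Option.some.injEq] at h
    subst h
    exact Conv.refl (hcross u)
  | cons e Q ih =>
    simp only [run] at h
    obtain ⟨w, hw, hQ⟩ := Option.bind_eq_some_iff.1 h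
    have he : ∀ v, run [e] (u ++ v) = some (w ++ v) := fun v => by
      simp [run, Event.act_append_right v hw]
    obtain ⟨n, hn, hn'⟩ := Event.act_length hw
    -- Here `n` counts the strands of `u` above `e`, so the crossing has height `e.pos + n + ins`
    -- before `e` and `e.pos + n + outs` after it, as `far` demands.
    have hmove : FrontMove [e, ⟨.cross (), w.length⟩] [⟨.cross (), u.length⟩, e] := by
      rw [← hn, ← hn']
      exact FrontMove.far e.kind (.cross ()) e.pos (e.pos + n) (by omega)
    have h1 : Conv FrontMove (u ++ a :: b :: v) (w ++ b :: a :: v)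
        [⟨.cross (), u.length⟩, e] [e, ⟨.cross (), w.length⟩] :=
      (Conv.of_move hmove (run_append_of_eq (he _) (hcross w))
        (run_append_of_eq (hcross u) (he _))).symm
    exact (h1.append_right (run_append_right _ hQ)).trans ((ih hQ).append_left (he _))

/-- A crossing below a part of a front moves from its left to its right. -/
theorem conv_cross_below {Q : List (Event Unit)} {u t : List Bool} (x : List Bool) (a b : Bool)
    (h : run Q u = some t) :
    Conv FrontMove (x ++ a :: b :: u) (x ++ b :: a :: t)
      (⟨.cross (), x.length⟩ :: Q.map (Event.shift (x.length + 2)))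
      (Q.map (Event.shift (x.length + 2)) ++ [⟨.cross (), x.length⟩]) := by
  have hcross : ∀ u : List Bool,
      run [(⟨.cross (), x.length⟩ : Event Unit)] (x ++ a :: b :: u) = some (x ++ b :: a :: u) :=
    fun u => by simp [run, Event.act]
  have hshift : ∀ (c d : Bool) {w : List (Event Unit)} {s s' : List Bool}, run w s = some s' →
      run (w.map (Event.shift (x.length + 2))) (x ++ c :: d :: s) = some (x ++ c :: d :: s') :=
    fun c d w s s' hw => by simpa using run_shift_of_eq (x ++ [c, d]) hw
  induction Q generalizing u with
  | nil =>
    simp only [run, Option.some.injEq] at h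
    subst h
    exact Conv.refl (hcross u)
  | cons e Q ih =>
    simp only [run] at h
    obtain ⟨w, hw, hQ⟩ := Option.bind_eq_some_iff.1 h
    have hw' : run [e] u = some w := by simp [run, hw]
    have hmove : FrontMove [⟨.cross (), x.length⟩, e.shift (x.length + 2)]
        [e.shift (x.length + 2), ⟨.cross (), x.length⟩] := by
      have := FrontMove.far (.cross ()) e.kind x.length (x.length + e.pos) (by omega)
      simpa only [Event.shift, Kind.ins, Kind.outs, Nat.add_right_comm] using this
    have h1 := Conv.of_move hmove
      (run_append_of_eq (hcross u) (hshift b a hw')) (run_append_of_eq (hshift a b hw') (hcross w))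
    exact (h1.append_right (hshift b a hQ)).trans ((ih hQ).append_left (hshift a b hw'))

/-! ### Surgeries and the crossing change -/

/-- A surgery inside a part `a` of a front: after an isotopy to `a₁ ++ a₂`, two oppositely oriented
strands between `a₁` and `a₂` are replaced by cusps, and the result is isotoped to `b`. -/
theorem exists_surgery {F : Front} {pre a a₁ a₂ b post : List (Event Unit)} {s t y z : List Bool}
    {c : Bool} (hF : F.word = pre ++ a ++ post) (hpre : run pre [] = some s)
    (h₁ : Conv FrontMove s t a (a₁ ++ a₂)) (hy : run a₁ s = some (y ++ c :: (!c) :: z))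
    (h₂ : Conv FrontMove s t (a₁ ++ [⟨.right, y.length⟩, ⟨.left !c, y.length⟩] ++ a₂) b) :
    ∃ F' : Front, F'.word = pre ++ b ++ post ∧ Surgery F.link F'.link := by
  have hc : run (pre ++ a ++ post) [] = some [] := hF ▸ F.closed
  let G : Front := ⟨pre ++ (a₁ ++ a₂) ++ post, closed_replace hpre h₁.1 h₁.2.1 hc⟩
  let G' : Front := ⟨pre ++ (a₁ ++ [⟨.right, y.length⟩, ⟨.left !c, y.length⟩] ++ a₂) ++ post,
    closed_replace hpre h₁.1 h₂.1 hc⟩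
  let F' : Front := ⟨pre ++ b ++ post, closed_replace hpre h₁.1 h₂.2.1 hc⟩
  refine ⟨F', rfl, G, G', pre ++ a₁, a₂ ++ post, _, y.length, !c,
    (h₁.2.2 pre post F G hpre hF rfl).symm, h₂.2.2 pre post G' F' hpre rfl rfl, ?_, ?_,
    run_append_of_eq hpre hy, ?_⟩
  · simp [G]
  · simp [G']
  · cases c <;> simp [run, Event.act]

theorem surgeryUnknottingNumber_le_two {L L₁ L₀ : LegendrianLink} (h₁ : Surgery L L₁)
    (h₀ : Surgery L₁ L₀) (hU : L₀.IsUnknot) : surgeryUnknottingNumber L ≤ 2 := by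
  refine iInf₂_le (α := ℕ∞) 2 ⟨![L₀, L₁, L], rfl, fun j => ?_, hU⟩
  fin_cases j
  · exact h₀
  · exact h₁

theorem run_map_smooth (w : List (Event Unit)) (s : List Bool) :
    run (w.map (Event.smooth true)) s = run w s := by
  induction w generalizing s with
  | nil => rfl
  | cons e w ih => simp only [List.map_cons, run, Event.act_smooth, ih]

/-- A front whose underlying smooth diagram agrees with the crossing change of `F`, up to a local
isotopy. -/
theorem isUnknot_of_changeCrossing {F F' : Front} {pre m b post : List (Event Unit)}
    {e : Event Unit} {p : ℕ} {s t : List Bool}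
    (hF : F.word = pre ++ (e :: ⟨.cross (), p⟩ :: m) ++ post) (hF' : F'.word = pre ++ b ++ post)
    (hpre : run pre [] = some s)
    (h : Conv SmoothMove s t (b.map (Event.smooth true))
      (e.smooth true :: ⟨.cross false, p⟩ :: m.map (Event.smooth true)))
    (hU : (Quot.mk _ (F.changeCrossing (pre.length + 1)) : LinkType) = unknot) :
    F'.link.IsUnknot := by
  have hmap : ∀ (w : List (Event Unit)) (f : ℕ → Bool), (∀ j < w.length, f j = true) →
      w.mapIdx (fun j e => e.smooth (f j)) = w.map (Event.smooth true) := fun w f hf => by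
    refine List.ext_getElem (by simp) fun j h₁ h₂ => ?_
    simp only [List.getElem_mapIdx, List.getElem_map]
    rw [hf j (by simpa using h₂)]
  have hpre' : run (pre.map (Event.smooth true)) [] = some s := (run_map_smooth _ _).trans hpre
  refine ⟨F', rfl, (h.2.2 (pre.map (Event.smooth true)) (post.map (Event.smooth true)) _ _ hpre'
    ?_ ?_).trans hU⟩
  · simp only [Front.diagram]
    rw [hF', hmap _ _ fun _ _ => rfl]
    simp
  · simp only [Front.changeCrossing]
    rw [hF, List.append_assoc, List.mapIdx_append, List.cons_append, List.cons_append,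
      List.mapIdx_cons, List.mapIdx_cons]
    -- Only the index `pre.length + 1` gets the label `false`: `pre` ends before `e`, and `m ++
    -- post` starts at `pre.length + 2`.
    rw [hmap pre _ fun j hj => by simp; omega,
      hmap (m ++ post) _ fun j hj => by simp; omega]
    simp [Event.smooth, Nat.add_comm]

/-- The strands next to a positive crossing that follows one other special point. -/
theorem Front.IsPositiveCrossing.strands {F : Front} {pre m : List (Event Unit)} {e : Event Unit}
    {p : ℕ} (hF : F.word = pre ++ e :: ⟨.cross (), p⟩ :: m)
    (h : F.IsPositiveCrossing (pre.length + 1)) :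
    ∃ (s s' : List Bool) (a : Bool), run pre [] = some s ∧ e.act s = some s' ∧
      s'[p]? = some a ∧ s'[p + 1]? = some a ∧ run (⟨.cross (), p⟩ :: m) s' = some [] := by
  obtain ⟨k, s', a, hk, hs', ha, ha'⟩ := h
  have hw : pre ++ e :: ⟨.cross (), p⟩ :: m = (pre ++ [e]) ++ ⟨.cross (), p⟩ :: m := by simp
  obtain rfl : p = k := by
    rw [hF, hw, List.getElem?_append_right (by simp)] at hk
    simpa using hk
  have ht : F.word.take (pre.length + 1) = pre ++ [e] := by
    rw [hF, hw, List.take_left' (by simp)]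
  rw [ht] at hs'
  obtain ⟨s, hs, he⟩ := exists_run_of_append hs'
  refine ⟨s, s', a, hs, by simpa [run] using he, ha, ha', ?_⟩
  have := F.closed
  rwa [hF, hw, run_append, hs'] at this

/-! ### S and Z forms -/

/-- The first surgery at a crossing of S or Z form leaves two opposite cusps; a second surgery turns
them into a crossing, with a zigzag in one of its strands. -/
theorem exists_surgery_cusps {F : Front} {pre post : List (Event Unit)} {x z : List Bool} {d : Bool}
    (hF : F.word = pre ++ [⟨.right, x.length⟩, ⟨.left d, x.length⟩] ++ post)
    (hpre : run pre [] = some (x ++ d :: (!d) :: z)) :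
    ∃ F' : Front, F'.word = pre ++ [⟨.cross (), x.length⟩, ⟨.left d, x.length + 2⟩,
      ⟨.right, x.length + 1⟩] ++ post ∧ Surgery F.link F'.link := by
  refine exists_surgery (t := x ++ (!d) :: d :: z)
    (a₁ := [⟨.left d, x.length + 2⟩, ⟨.cross (), x.length + 1⟩, ⟨.cross (), x.length⟩])
    (a₂ := [⟨.right, x.length + 1⟩]) (y := x ++ [!d, d]) (c := !d) (z := z)
    hF hpre ?_ ?_ ?_
  -- The left cusp is moved to the left of the right cusp, which then crosses its lower branch by
  -- move II.
  · refine (Conv.of_move_within [] [] (FrontMove.far .right (.left d) x.length x.length le_rfl) ?_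
      ?_).trans (Conv.of_move_within [⟨.left d, x.length + 2⟩] [] (FrontMove.r2Right x.length) ?_
      ?_).symm <;>
    cases d <;> simp [run_nil, run_cons_add, run_cons_length, Event.act, Kind.ins, Kind.outs,
      Nat.add_assoc]
  · cases d <;> simp [run_nil, run_cons_add, run_cons_length, Event.act, Nat.add_assoc]
  · simp only [List.length_append, List.length_cons, List.length_nil, Nat.zero_add, Bool.not_not,
      Nat.reduceAdd]
    -- Once the lower crossing is out of the way, the new right cusp closes the upper one into a
    -- loop of move I.
    refine (Conv.of_move_within [⟨.left d, x.length + 2⟩, ⟨.cross (), x.length + 1⟩]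
      [⟨.left d, x.length + 2⟩, ⟨.right, x.length + 1⟩]
      (FrontMove.far (.cross ()) .right x.length x.length le_rfl) ?_ ?_).trans
      (Conv.of_move_within [] [⟨.cross (), x.length⟩, ⟨.left d, x.length + 2⟩,
        ⟨.right, x.length + 1⟩] (FrontMove.r1 (x.length + 1) d) ?_ ?_) <;>
    cases d <;> simp [run_nil, run_cons_add, run_cons_length, Event.act, Kind.ins, Kind.outs,
      Nat.add_assoc]

theorem surgeryUnknottingNumber_le_two_of_isSForm {F : Front} {i : ℕ} (hpos : F.IsPositiveCrossing i)
    (hS : F.IsSForm i) (hU : (Quot.mk _ (F.changeCrossing i) : LinkType) = unknot) :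
    surgeryUnknottingNumber F.link ≤ 2 := by
  obtain ⟨pre, post, k, d, rfl, hF⟩ := hS
  obtain ⟨s, s', a, hs, he, ha, ha', hrest⟩ := hpos.strands (by simpa using hF)
  obtain ⟨x, p, q, z, rfl, rfl⟩ : ∃ x p q z, k = x.length ∧ s = x ++ p :: q :: z := by
    have hk : k + 2 ≤ s.length := by
      by_contra hk
      simp [Event.act, hk] at he
    refine ⟨s.take k, s[k], s[k + 1], s.drop (k + 2), by simp; omega, ?_⟩
    simp
  -- Positivity gives `q = !d`; coherence at the right cusp excludes `p = !d`. The two strands are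
  -- thus opposite, as surgery requires.
  have hd : d = p ∧ q = !p := by
    simp only [act_add] at he
    simp [Event.act] at he
    subst he
    rw [run_cons_add] at hrest
    simp [Event.act, run_cons_length] at hrest
    simp at ha ha'
    grind
  obtain ⟨rfl, rfl⟩ := hd
  have hR : run [(⟨.left d, x.length + 2⟩ : Event Unit), ⟨.cross (), x.length + 1⟩,
      ⟨.right, x.length⟩] (x ++ d :: (!d) :: z) = some (x ++ (!d) :: d :: z) := by
    cases d <;> simp [run_nil, run_cons_add, run_cons_length, Event.act]
  obtain ⟨F₁, hF₁, hS₁⟩ := exists_surgery (F := F) (pre := pre) (post := post) (a₁ := [])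
    (a₂ := [⟨.left d, x.length + 2⟩, ⟨.cross (), x.length + 1⟩, ⟨.right, x.length⟩])
    (b := [⟨.right, x.length⟩, ⟨.left d, x.length⟩]) (t := x ++ (!d) :: d :: z)
    hF hs (.refl hR) rfl (by
      -- The left cusp of the S trades places with that of the surgery, which then forms a move I
      -- loop with the crossing and the right cusp.
      refine (Conv.of_move_within [⟨.right, x.length⟩] [⟨.cross (), x.length + 1⟩,
        ⟨.right, x.length⟩] (FrontMove.far (.left !d) (.left d) x.length x.length le_rfl) ?_
        ?_).trans (Conv.of_move_within [⟨.right, x.length⟩, ⟨.left d, x.length⟩] []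
          (FrontMove.r1' x.length !d) ?_ ?_) <;>
      cases d <;>
      simp [run_nil, run_cons_add, run_cons_length, Event.act, Kind.ins, Kind.outs,
      Nat.add_assoc])
  obtain ⟨F₂, hF₂, hS₂⟩ := exists_surgery_cusps hF₁ hs
  refine surgeryUnknottingNumber_le_two hS₁ hS₂ (isUnknot_of_changeCrossing (t := x ++ (!d) :: d :: z)
    (m := [⟨.right, x.length⟩]) hF hF₂ hs ?_ hU)
  -- With the left cusp moved to the front, turning the crossing past the right cusp flips its
  -- label.
  refine (Conv.of_move_within [] [⟨.right, x.length + 1⟩]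
    (SmoothMove.far (.cross true) (.left d) x.length x.length le_rfl) ?_ ?_).trans
    (Conv.of_move_within [⟨.left d, x.length + 2⟩] []
      (SmoothMove.turnRight x.length false) ?_ ?_).symm <;>
  cases d <;>
  simp [run_nil, run_cons_add, run_cons_length, Event.act, Kind.ins, Kind.outs,
      Nat.add_assoc]

theorem surgeryUnknottingNumber_le_two_of_isZForm {F : Front} {i : ℕ} (hpos : F.IsPositiveCrossing i)
    (hZ : F.IsZForm i) (hU : (Quot.mk _ (F.changeCrossing i) : LinkType) = unknot) :
    surgeryUnknottingNumber F.link ≤ 2 := by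
  obtain ⟨pre, post, k, d, rfl, hF⟩ := hZ
  obtain ⟨s, s', a, hs, he, ha, ha', hrest⟩ := hpos.strands (by simpa using hF)
  obtain ⟨x, y, rfl, rfl⟩ : ∃ x y, k = x.length ∧ s = x ++ y := by
    have hk : k ≤ s.length := by
      by_contra hk
      simp [Event.act, hk] at he
    exact ⟨s.take k, s.drop k, by simp; omega, by simp⟩
  -- The first entry comes from positivity, the second from coherence at the right cusp.
  obtain ⟨z, rfl⟩ : ∃ z, y = d :: (!d) :: z := by
    simp only [act_length] at he
    simp [Event.act] at he
    subst he
    simp at ha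
    rw [run_cons_add] at hrest
    rcases y with _ | ⟨p, _ | ⟨q, z⟩⟩
    · simp [Event.act] at hrest
    · simp [Event.act, run_cons_add] at hrest
    · simp [Event.act, run_cons_add] at hrest
      rw [List.getElem?_append_right (by omega)] at ha'
      simp [Nat.add_assoc] at ha'
      cases p <;> cases q <;> cases d <;> simp_all
  have hR : run [(⟨.left d, x.length⟩ : Event Unit), ⟨.cross (), x.length + 1⟩,
      ⟨.right, x.length + 2⟩] (x ++ d :: (!d) :: z) = some (x ++ (!d) :: d :: z) := by
    cases d <;> simp [run_nil, run_cons_add, run_cons_length, Event.act]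
  obtain ⟨F₁, hF₁, hS₁⟩ := exists_surgery (F := F) (pre := pre) (post := post) (a₁ := [])
    (a₂ := [⟨.left d, x.length⟩, ⟨.cross (), x.length + 1⟩, ⟨.right, x.length + 2⟩])
    (b := [⟨.right, x.length⟩, ⟨.left d, x.length⟩]) (t := x ++ (!d) :: d :: z)
    hF hs (.refl hR) rfl (by
      refine (Conv.of_move_within [⟨.right, x.length⟩] [⟨.cross (), x.length + 1⟩,
        ⟨.right, x.length + 2⟩] (FrontMove.far (.left d) (.left !d) x.length x.length le_rfl) ?_
        ?_).symm.trans (Conv.of_move_within [⟨.right, x.length⟩, ⟨.left d, x.length⟩] []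
          (FrontMove.r1 (x.length + 1) !d) ?_ ?_) <;>
      cases d <;>
      simp [run_nil, run_cons_add, run_cons_length, Event.act, Kind.ins, Kind.outs,
      Nat.add_assoc])
  obtain ⟨F₂, hF₂, hS₂⟩ := exists_surgery_cusps hF₁ hs
  refine surgeryUnknottingNumber_le_two hS₁ hS₂ (isUnknot_of_changeCrossing (t := x ++ (!d) :: d :: z)
    (m := [⟨.right, x.length + 2⟩]) hF hF₂ hs ?_ hU)
  -- The zigzag left by the surgery is straightened and one of the opposite shape is inserted on the
  -- left of the crossing; its left turning point is the one the crossing is turned past.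
  refine (Conv.of_move_within [⟨.cross true, x.length⟩] [] (SmoothMove.zigzag (x.length + 1) d) ?_
    ?_).trans (Conv.of_move_within [] [⟨.cross true, x.length⟩]
      (SmoothMove.zigzag' (x.length + 1) d) ?_ ?_).symm |>.trans
    (Conv.of_move_within [⟨.left d, x.length + 1⟩] []
      (SmoothMove.far (.cross true) .right x.length x.length le_rfl) ?_ ?_).symm |>.trans
    (Conv.of_move_within [] [⟨.right, x.length + 2⟩]
      (SmoothMove.turnLeft x.length d false) ?_ ?_).symm <;>
  cases d <;>
  simp [run_nil, run_cons_add, run_cons_length, Event.act, Kind.ins, Kind.outs,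
      Nat.add_assoc]

/-! ### Hooked-X form -/

theorem surgeryUnknottingNumber_le_two_of_isUpperHookedX {F : Front} {i : ℕ}
    (hpos : F.IsPositiveCrossing i) (hX : F.IsUpperHookedX i)
    (hU : (Quot.mk _ (F.changeCrossing i) : LinkType) = unknot) :
    surgeryUnknottingNumber F.link ≤ 2 := by
  obtain ⟨pre, Q, post, k, d, rfl, hF, hQ⟩ := hX
  obtain ⟨s, s', a, hs, he, ha, ha', hrest⟩ := hpos.strands (by simpa using hF)
  obtain ⟨x, p, y, rfl, rfl⟩ : ∃ x p y, k = x.length ∧ s = x ++ p :: y := by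
    have hk : k + 1 ≤ s.length := by
      by_contra hk
      simp [Event.act, hk] at he
    exact ⟨s.take k, s[k], s.drop (k + 1), by simp; omega, by simp⟩
  obtain ⟨Q, rfl⟩ : ∃ Q₀ : List (Event Unit), Q = Q₀.map (Event.shift (x.length + 2)) := by
    -- The subtraction is not truncated, by `hQ`.
    refine ⟨Q.map fun e => ⟨e.kind, e.pos - (x.length + 2)⟩, ?_⟩
    rw [List.map_map]
    refine (List.map_id Q).symm.trans (List.map_congr_left fun e he => ?_)
    simp [Event.shift, Nat.add_sub_cancel' (hQ e he)]
  simp only [act_add] at he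
  simp [Event.act] at he
  subst he
  simp at ha ha'
  obtain rfl : p = !d := by rw [ha, ha']; simp
  have hshift : ∀ (b c : Bool) {s s' : List Bool}, run Q s = some s' →
      run (Q.map (Event.shift (x.length + 2))) (x ++ b :: c :: s) = some (x ++ b :: c :: s') :=
    fun b c s s' h => by simpa using run_shift_of_eq (x ++ [b, c]) h
  -- The closing right cusp joins a strand of direction `!d` to the lowest strand that leaves `Q`,
  -- so the latter has direction `d`.
  obtain ⟨z, hQz⟩ : ∃ z, run Q (d :: y) = some (d :: z) := by
    have h₀ := run_shift Q (x ++ [!d, !d]) (d :: y)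
    simp only [run_cons_length, Event.act] at hrest
    simp [run_append] at hrest
    simp at h₀
    rw [h₀] at hrest
    rcases hr : run Q (d :: y) with _ | ⟨_ | ⟨c, z⟩⟩
    · simp [hr] at hrest
    · simp [hr, run_cons_add, Event.act] at hrest
    · simp [hr, run_cons_add, Event.act] at hrest
      obtain rfl : c = d := by cases c <;> cases d <;> simp at hrest ⊢
      exact ⟨z, rfl⟩
  have hW : run (Q.map (Event.shift (x.length + 2)) ++ [⟨.right, x.length + 1⟩])
      (x ++ (!d) :: (!d) :: d :: y) = some (x ++ (!d) :: z) :=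
    run_append_of_eq (hshift _ _ hQz)
      (by cases d <;> simp [run_nil, run_cons_add, Event.act])
  generalize hQ' : Q.map (Event.shift (x.length + 2)) = Q' at *
  obtain ⟨F₁, hF₁, hS₁⟩ := exists_surgery (F := F) (pre := pre) (post := post)
    (a := [⟨.left d, x.length + 1⟩, ⟨.cross (), x.length⟩] ++ (Q' ++ [⟨.right, x.length + 1⟩]))
    (a₁ := [⟨.left d, x.length + 1⟩, ⟨.cross (), x.length⟩]) (a₂ := Q' ++ [⟨.right, x.length + 1⟩])
    (b := [⟨.left d, x.length + 1⟩] ++ (Q' ++ [⟨.right, x.length + 1⟩])) (y := x ++ [!d]) (c := !d)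
    (z := y) (t := x ++ (!d) :: z) (by simpa using hF) hs
    (.refl (run_append_of_eq (by simp [run_nil, run_cons_add, run_cons_length, Event.act]) hW))
    (by simp [run_nil, run_cons_add, run_cons_length, Event.act])
    (by
      simp only [List.length_append, List.length_cons, List.length_nil, Nat.zero_add, Bool.not_not]
      refine Conv.append_right (t := x ++ (!d) :: (!d) :: d :: y) (Conv.of_move_within []
        [⟨.left d, x.length + 1⟩] (FrontMove.r1 x.length d) ?_ ?_) hW <;>
      cases d <;>
      simp [run_nil, run_cons_add, run_cons_length, Event.act])
  have hcross := conv_cross_below x (!d) (!d) hQz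
  rw [hQ'] at hcross
  have hl : run [(⟨.left d, x.length⟩ : Event Unit), ⟨.cross (), x.length + 1⟩]
      (x ++ (!d) :: y) = some (x ++ (!d) :: (!d) :: d :: y) := by
    cases d <;> simp [run_nil, run_cons_add, run_cons_length, Event.act]
  have hlQ := run_append_of_eq hl (hshift (!d) (!d) hQz)
  have hr : run [(⟨.right, x.length + 1⟩ : Event Unit)] (x ++ (!d) :: (!d) :: d :: z) =
      some (x ++ (!d) :: z) := by
    cases d <;> simp [run_nil, run_cons_add, Event.act]
  -- Move II splits the left cusp into a cusp and two crossings. The second crossing slides past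
  -- `Q'`, and the surgery just before it makes it part of a move I loop.
  obtain ⟨F₂, hF₂, hS₂⟩ := exists_surgery (F := F₁) (pre := pre) (post := post)
    (a₁ := [⟨.left d, x.length⟩, ⟨.cross (), x.length + 1⟩] ++ Q')
    (a₂ := [⟨.cross (), x.length⟩, ⟨.right, x.length + 1⟩])
    (b := [⟨.left d, x.length⟩, ⟨.cross (), x.length + 1⟩] ++ Q' ++ [⟨.right, x.length + 1⟩])
    (y := x ++ [!d]) (c := !d) (z := z) (t := x ++ (!d) :: z) hF₁ hs
    (by
      refine (Conv.append_right (t := x ++ (!d) :: (!d) :: d :: y) (Conv.of_move_within [] []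
        (FrontMove.r2Left' x.length d) ?_ ?_).symm hW).trans
        (by simpa using (hcross.append_left hl).append_right hr) <;>
      cases d <;> simp [run_nil, run_cons_add, run_cons_length, Event.act])
    (by simpa using hlQ)
    (by
      simp only [List.length_append, List.length_cons, List.length_nil, Nat.zero_add, Bool.not_not]
      have h := (Conv.of_move (s := x ++ (!d) :: z) (t := x ++ (!d) :: z)
        (FrontMove.r1 x.length d)
        (by cases d <;> simp [run_nil, run_cons_add, run_cons_length, Event.act]) rfl)
      simpa using (h.append_left hr).append_left hlQ)
  refine surgeryUnknottingNumber_le_two hS₁ hS₂ (isUnknot_of_changeCrossing (t := x ++ (!d) :: z)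
    (m := Q' ++ [⟨.right, x.length + 1⟩]) (by simpa using hF) hF₂ hs ?_ hU)
  have hW' := (run_map_smooth _ _).trans hW
  have h := (Conv.of_move (s := x ++ (!d) :: y) (t := x ++ (!d) :: (!d) :: d :: y)
    (SmoothMove.turnLeft x.length d true)
    (by cases d <;> simp [run_nil, run_cons_add, run_cons_length, Event.act])
    (by cases d <;> simp [run_nil, run_cons_add, run_cons_length, Event.act])).append_right
    hW'
  simpa [Event.smooth] using h

/-- The argument for the upper hooks, reflected. Since `Q` now lies below, the sliding crossing
changes height, from `k + 1` to `l + 1`. -/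
theorem surgeryUnknottingNumber_le_two_of_isLowerHookedX {F : Front} {i : ℕ}
    (hpos : F.IsPositiveCrossing i) (hX : F.IsLowerHookedX i)
    (hU : (Quot.mk _ (F.changeCrossing i) : LinkType) = unknot) :
    surgeryUnknottingNumber F.link ≤ 2 := by
  obtain ⟨pre, Q, post, k, l, d, s₁, t, rfl, hF, hs₁, hQ, ht⟩ := hX
  obtain ⟨s, s', a, hs, he, ha, ha', hrest⟩ := hpos.strands (by simpa using hF)
  obtain ⟨x, y, rfl, rfl⟩ : ∃ x y, k = x.length ∧ s = x ++ y := by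
    have hk : k ≤ s.length := by
      by_contra hk
      simp [Event.act, hk] at he
    exact ⟨s.take k, s.drop k, by simp; omega, by simp⟩
  obtain ⟨v, c, rfl⟩ : ∃ v c, t = v ++ [c] := by
    have h : t ≠ [] := List.ne_nil_of_length_eq_add_one ht
    exact ⟨t.dropLast, t.getLast h, (List.dropLast_append_getLast h).symm⟩
  obtain rfl : l = v.length := by simpa using ht.symm
  simp only [act_length] at he
  simp [Event.act] at he
  subst he
  simp at ha
  obtain ⟨y, rfl⟩ : ∃ z, y = d :: z := by
    rcases y with _ | ⟨p, y⟩
    · simp [run_cons_add, Event.act] at hrest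
    · rw [List.getElem?_append_right (by omega)] at ha'
      simp [Nat.add_assoc] at ha'
      exact ⟨y, by rw [ha, ha']⟩
  have hcr : run [(⟨.left d, x.length⟩ : Event Unit), ⟨.cross (), x.length + 1⟩] (x ++ d :: y) =
      some (x ++ (!d) :: d :: d :: y) := by simp [run_nil, run_cons_add, run_cons_length, Event.act]
  rw [run_append_of_eq hs hcr, Option.some.injEq] at hs₁
  subst hs₁
  -- `Q` fits on the lowest `k + 1` strands alone, so arbitrary strands can be stacked above it.
  have hQr : run Q (x ++ [!d]) = some (v ++ [c]) := by
    have hx : (x ++ (!d) :: d :: d :: y).take (x.length + 1) = x ++ [!d] := by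
      rw [List.take_append, List.take_of_length_le (by omega), Nat.add_sub_cancel_left]; rfl
    rw [hx] at hQ
    exact hQ
  have hQv : ∀ w, run Q (x ++ (!d) :: w) = some (v ++ c :: w) := fun w => by
    simpa using run_append_right w hQr
  -- Coherence at the closing right cusp, whose upper strand has direction `d`.
  obtain rfl : c = !d := by
    rw [run_cons_add] at hrest
    simp [Event.act, run_append, hQv, run_cons_length] at hrest
    cases c <;> cases d <;> simp at hrest ⊢
  have hr : ∀ w, run [(⟨.right, v.length⟩ : Event Unit)] (v ++ (!d) :: d :: w) = some (v ++ w) :=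
    fun w => by cases d <;> simp [run_nil, run_cons_length, Event.act]
  have hW := run_append_of_eq (hQv (d :: d :: y)) (hr (d :: y))
  obtain ⟨F₁, hF₁, hS₁⟩ := exists_surgery (F := F) (pre := pre) (post := post)
    (a := [⟨.left d, x.length⟩, ⟨.cross (), x.length + 1⟩] ++ (Q ++ [⟨.right, v.length⟩]))
    (a₁ := [⟨.left d, x.length⟩, ⟨.cross (), x.length + 1⟩]) (a₂ := Q ++ [⟨.right, v.length⟩])
    (b := [⟨.left d, x.length⟩] ++ (Q ++ [⟨.right, v.length⟩])) (y := x) (c := !d)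
    (z := d :: y) (t := v ++ d :: y) (by simpa using hF) hs (.refl (run_append_of_eq hcr hW))
    (by simpa using hcr)
    (by
      simp only [Bool.not_not]
      refine Conv.append_right (t := x ++ (!d) :: d :: d :: y) (Conv.of_move_within []
        [⟨.left d, x.length⟩] (FrontMove.r1' x.length d) ?_ ?_) hW <;>
      cases d <;> simp [run_nil, run_cons_add, run_cons_length, Event.act])
  have hcross := conv_cross_above d d y (hQv [])
  have hl : run [(⟨.left d, x.length + 1⟩ : Event Unit), ⟨.cross (), x.length⟩] (x ++ d :: y) =
      some (x ++ (!d) :: d :: d :: y) := by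
    cases d <;> simp [run_nil, run_cons_add, run_cons_length, Event.act]
  have hlQ := run_append_of_eq hl (hQv _)
  simp only [List.append_assoc, List.cons_append, List.nil_append, List.length_append,
    List.length_cons, List.length_nil, Nat.zero_add] at hcross
  have hmove := (hcross.append_left hl).append_right (hr (d :: y))
  obtain ⟨F₂, hF₂, hS₂⟩ := exists_surgery (F := F₁) (pre := pre) (post := post)
    (a₁ := [⟨.left d, x.length + 1⟩, ⟨.cross (), x.length⟩] ++ Q)
    (a₂ := [⟨.cross (), v.length + 1⟩, ⟨.right, v.length⟩])
    (b := [⟨.left d, x.length + 1⟩, ⟨.cross (), x.length⟩] ++ Q ++ [⟨.right, v.length⟩])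
    (y := v) (c := !d) (z := d :: y) (t := v ++ d :: y) hF₁ hs
    (by
      refine (Conv.append_right (t := x ++ (!d) :: d :: d :: y) (Conv.of_move_within [] []
        (FrontMove.r2Left x.length d) ?_ ?_).symm hW).trans
        (by simpa using hmove) <;>
      cases d <;> simp [run_nil, run_cons_add, run_cons_length, Event.act])
    (by simpa using hlQ)
    (by
      simp only [Bool.not_not]
      have h := (Conv.of_move (s := v ++ d :: y) (t := v ++ d :: y)
        (FrontMove.r1' v.length d)
        (by cases d <;> simp [run_nil, run_cons_add, run_cons_length, Event.act]) rfl)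
      simpa using (h.append_left (hr _)).append_left hlQ)
  refine surgeryUnknottingNumber_le_two hS₁ hS₂ (isUnknot_of_changeCrossing (t := v ++ d :: y)
    (m := Q ++ [⟨.right, v.length⟩]) (by simpa using hF) hF₂ hs ?_ hU)
  have h := (Conv.of_move (s := x ++ d :: y) (t := x ++ (!d) :: d :: d :: y)
    (SmoothMove.turnLeft x.length d false)
    (by cases d <;> simp [run_nil, run_cons_add, run_cons_length, Event.act])
    (by cases d <;> simp [run_nil, run_cons_add, run_cons_length, Event.act])).symm.append_right
    ((run_map_smooth _ _).trans hW)
  simpa [Event.smooth] using h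

end Legendrian

open Legendrian in
theorem lemma5p4 (L : LegendrianLink) (hknot : L.IsKnot) (hnontrivial : ¬ L.IsUnknot)
    (h : ∃ (F : Front) (i : ℕ), F.link = L ∧ F.IsPositiveCrossing i ∧
      (F.IsSForm i ∨ F.IsZForm i ∨ F.IsHookedXForm i) ∧
      (Quot.mk _ (F.changeCrossing i) : LinkType) = unknot) :
    surgeryUnknottingNumber L ≤ 2 := by
  obtain ⟨F, i, rfl, hpos, hS | hZ | hX | hX, hU⟩ := h
  · exact surgeryUnknottingNumber_le_two_of_isSForm hpos hS hU
  · exact surgeryUnknottingNumber_le_two_of_isZForm hpos hZ hU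
  · exact surgeryUnknottingNumber_le_two_of_isUpperHookedX hpos hX hU
  · exact surgeryUnknottingNumber_le_two_of_isLowerHookedX hpos hX hU
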